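/- Let $X$ be a finite set. The spin model planar algebra on $X$ has $k$-box space $\mathscr P_k=\{f\colon X^k\to\mathbb C\}$, $k\ge 0$, with planar tangles acting by the usual partition function (a sum over the spins, i.e. elements of $X$, assigned to the internal shaded regions). If a group $G$ acts on $X$, the group-action model $\mathscr P^G_\bullet\subseteq\mathscr P_\bullet$ consists of the functions invariant under the diagonal action of $G$ on $X^k$. A planar subalgebra is a family of linear subspaces closed under all planar tangles; it is *generated* by a set of boxes if it is the smallest planar subalgebra that contains them. For a finite graph $\Gamma$ with vertex set $V$, let $\mathscr P^\Gamma_\bullet$ be the group-action model of $\mathrm{Aut}(\Gamma)$ acting on $V$; the adjacency matrix $A_\Gamma$ is a 2-box of it. The graph $\Gamma$ has *property (G)* if $\mathscr P^\Gamma_\bullet$ is generated by $A_\Gamma$. The Kneser graph $KG_{n,2}$ has as vertices the 2-element subsets of $\{1,\dots,n\}$, two of them being adjacent if and only if they are disjoint. **Theorem.** For every $n\ge 5$, the Kneser graph $KG_{n,2}$ has property (G). Moreover, the group-action model of $S_n$ acting on the vertices of $KG_{n,2}$ is generated by the adjacency matrix of $KG_{n,2}$, and hence by its 2-boxes. In particular,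 the group-action model of $S_n$ acting on the cosets of its subgroup $S_2\times S_{n-2}$ is generated by its 2-boxes. -/

import Mathlib

open scoped Pointwise

/-- The `n`-box space of the spin model on `X`: complex-valued functions on `X ^ n`.
A function of `n` spins is drawn as a box whose boundary meets `n` shaded intervals (equivalently,
`2 * n` strings); the spins of these shaded intervals, read in cyclic order from the base point,
are the arguments. -/
abbrev SpinBox (X : Type*) (n : ℕ) : Type _ := (Fin n → X) → ℂ

open Classical in
/-- A planar subalgebra of the spin model on `X`: a family of subspaces of the box spaces that is
stable under the action of planar tangles, given by the elementary tangles of which every planar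
tangle is a composition, acting by the partition function (sum over the spins of the internal
shaded regions). Permutations of the arguments other than cyclic ones are not planar and are
not included. -/
structure IsPlanarSubalgebra {X : Type*} [Finite X] (Q : ∀ n, Submodule ℂ (SpinBox X n)) :
    Prop where
  /-- the empty tangle -/
  one_mem : (fun _ => 1 : SpinBox X 0) ∈ Q 0
  /-- juxtaposition of two boxes (tensor product) -/
  tensor_mem : ∀ {m n : ℕ} {f : SpinBox X m} {g : SpinBox X n}, f ∈ Q m → g ∈ Q n →
    (fun x => f (fun i => x (Fin.castAdd n i)) * g (fun j => x (Fin.natAdd m j)) :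
      SpinBox X (m + n)) ∈ Q (m + n)
  /-- rotation: `(x₁, …, xₙ) ↦ f (x₂, …, xₙ, x₁)` -/
  rotate_mem : ∀ {n : ℕ} {f : SpinBox X n}, f ∈ Q n →
    (fun x => f (fun i => x (finRotate n i)) : SpinBox X n) ∈ Q n
  /-- cap closing off the `k`-th shaded interval, whose spin becomes internal and is summed over -/
  cap_mem : ∀ {n : ℕ} {f : SpinBox X (n + 1)} (k : Fin (n + 1)), f ∈ Q (n + 1) →
    (fun x => ∑ᶠ a : X, f (k.insertNth a x) : SpinBox X n) ∈ Q n
  /-- cap closing off the unshaded interval between the `k`-th and the next shaded interval, which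
  become part of one shaded region: `f (…, xₖ, xₖ, …)` -/
  merge_mem : ∀ {n : ℕ} {f : SpinBox X (n + 2)} (k : Fin (n + 1)), f ∈ Q (n + 2) →
    (fun x => f (fun i => x (k.predAbove i)) : SpinBox X (n + 1)) ∈ Q (n + 1)
  /-- cup creating a new shaded interval in position `k`, whose spin is unconstrained -/
  cup_mem : ∀ {n : ℕ} {f : SpinBox X n} (k : Fin (n + 1)), f ∈ Q n →
    (fun x => f (k.removeNth x) : SpinBox X (n + 1)) ∈ Q (n + 1)
  /-- cup creating an unshaded interval that splits the `k`-th shaded interval into two intervals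
  of the same shaded region: `δ(xₖ, xₖ₊₁) f (…, xₖ, xₖ₊₂, …)` -/
  split_mem : ∀ {n : ℕ} {f : SpinBox X (n + 1)} (k : Fin (n + 1)), f ∈ Q (n + 1) →
    (fun x => if x k.castSucc = x k.succ then f (k.castSucc.removeNth x) else 0 :
      SpinBox X (n + 2)) ∈ Q (n + 2)

/-- The `n`-box space of the planar subalgebra of the spin model on `X` generated by a set `S` of
`m`-boxes: the intersection of all planar subalgebras containing `S`. -/
def planarGenerated {X : Type*} [Finite X] {m : ℕ} (S : Set (SpinBox X m)) (n : ℕ) :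
    Submodule ℂ (SpinBox X n) :=
  sInf {W | ∃ Q : ∀ k, Submodule ℂ (SpinBox X k), IsPlanarSubalgebra Q ∧ S ⊆ Q m ∧ Q n = W}

/-- The group-action model: the `n`-boxes of the spin model on `X` that are fixed under the
diagonal action of `G` on `X ^ n`. -/
def groupActionModel (G X : Type*) [Group G] [MulAction G X] (n : ℕ) :
    Submodule ℂ (SpinBox X n) where
  carrier := {f | ∀ (g : G) (x : Fin n → X), f (fun i => g • x i) = f x}
  zero_mem' := fun _ _ => rfl
  add_mem' := fun {a b} ha hb g x => by
    change a _ + b _ = a x + b x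
    rw [ha, hb]
  smul_mem' := fun c f hf g x => by
    change c • f _ = c • f x
    rw [hf]

/-- The group-action model of `G` acting on `X` is generated, as a planar algebra, by its
2-boxes. -/
def GeneratedByTwoBoxes (G X : Type*) [Group G] [MulAction G X] [Finite X] : Prop :=
  ∀ k : ℕ, planarGenerated (groupActionModel G X 2 : Set (SpinBox X 2)) k = groupActionModel G X k

open Classical in
/-- The adjacency matrix of a graph, as a 2-box of the spin model on its vertices. -/
noncomputable def adjacencyBox {V : Type*} (Γ : SimpleGraph V) : SpinBox V 2 :=
  fun x => if Γ.Adj (x 0) (x 1) then 1 else 0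

/-- Property (G): the group-action model of the automorphism group of `Γ` acting on its vertices is
generated, as a planar algebra, by the adjacency matrix. -/
def PropertyG {V : Type*} [Finite V] (Γ : SimpleGraph V) : Prop :=
  ∀ k : ℕ, planarGenerated {adjacencyBox Γ} k = groupActionModel (Γ ≃g Γ) V k

/-- The Kneser graph: the vertices are the `r`-element subsets of an `n`-element set, and two
different ones are adjacent when they are disjoint. -/
def kneserGraph (n r : ℕ) : SimpleGraph (Set.powersetCard (Fin n) r) where
  Adj s t := s ≠ t ∧ Disjoint (s : Finset (Fin n)) (t : Finset (Fin n))
  symm := ⟨fun _ _ h => ⟨h.1.symm, h.2.symm⟩⟩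
  loopless := ⟨fun _ h => h.1 rfl⟩

/-- The subgroup `S_2 × S_{n-2}` of `S_n`: the permutations that preserve `{0, 1}`. -/
def twoSubsetSubgroup (n : ℕ) : Subgroup (Equiv.Perm (Fin n)) :=
  MulAction.stabilizer (Equiv.Perm (Fin n)) {i : Fin n | (i : ℕ) < 2}

/-! Label the spins by the pairs from an `n`-set and let a planar subalgebra contain the
disjointness relation. The heart of the matter is that it also contains the crossing `[x₀ = x₂][x₁ =
x₃]`; then it is closed under arbitrary permutations of arguments, and planarity is no longer a
constraint.

To get the crossing, view labels as edges of the complete graph. The relation of meeting in one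
point is `1 - δ - D`, with `D` the disjointness relation. Counting the edges that meet three
pairwise meeting edges gives `0` for a triangle and `n - 4` for a star, so for `n ≥ 5` the triangle
relation is a 3-box of the subalgebra (`tri_mem`). Two edges of a triangle determine the third,
hence four triangles around a common edge force opposite edges to coincide: this is the crossing
restricted to meeting pairs (`crossing_meets_mem`). For disjoint pairs, one strand is opened into a
triangle bigon whose two sides meet the other strand, and that strand is drawn across the bigon by
crossings already available (`crossing_disjoint_mem`). Adding the diagonal gives the full crossing.

With the crossing, box spaces are closed under pointwise products, so the indicator of the self-maps
of the vertex set that preserve and reflect disjointness is itself a box. Averaging over these maps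
reproduces every box that they leave invariant (`mem_of_invariant`). For `n ≥ 5` such maps come from
permutations of the points (`exists_perm`), which yields all `S_n`-invariant boxes. -/

/-! ### Composite tangles -/

namespace IsPlanarSubalgebra

variable {X : Type*} [Finite X] {Q : ∀ n, Submodule ℂ (SpinBox X n)}

open Classical in
theorem delta_mem (hQ : IsPlanarSubalgebra Q) :
    (fun x => if x 0 = x 1 then 1 else 0 : SpinBox X 2) ∈ Q 2 :=
  hQ.split_mem 0 (hQ.cup_mem 0 hQ.one_mem)

theorem one_mem_two (hQ : IsPlanarSubalgebra Q) : (fun _ => 1 : SpinBox X 2) ∈ Q 2 :=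
  hQ.cup_mem 0 (hQ.cup_mem 0 hQ.one_mem)

variable [Fintype X]

theorem sum_mem (hQ : IsPlanarSubalgebra Q) {n : ℕ} {f : SpinBox X (n + 1)} (k : Fin (n + 1))
    (hf : f ∈ Q (n + 1)) : (fun x => ∑ a : X, f (k.insertNth a x) : SpinBox X n) ∈ Q n := by
  simpa only [finsum_eq_sum_of_fintype] using hQ.cap_mem k hf

/-- Three two-boxes meeting in an internal region. -/
theorem tripod_mem (hQ : IsPlanarSubalgebra Q) {F : X → X → ℂ}
    (hF : (fun x => F (x 0) (x 1) : SpinBox X 2) ∈ Q 2) :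
    (fun x => ∑ y, F (x 0) y * F (x 1) y * F (x 2) y : SpinBox X 3) ∈ Q 3 := by
  have h1 : (fun x => F (x 1) (x 0) : SpinBox X 2) ∈ Q 2 := hQ.rotate_mem hF
  have h2 : (fun x => F (x 1) (x 0) * F (x 2) (x 3) : SpinBox X 4) ∈ Q 4 := hQ.tensor_mem h1 hF
  have h3 : (fun x => F (x 2) (x 1) * F (x 3) (x 0) : SpinBox X 4) ∈ Q 4 := hQ.rotate_mem h2
  have h4 : (fun x => F (x 1) (x 0) * F (x 2) (x 0) : SpinBox X 3) ∈ Q 3 := hQ.merge_mem 0 h3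
  have h5 : (fun x => F (x 1) (x 0) * F (x 2) (x 0) * F (x 3) (x 4) : SpinBox X 5) ∈ Q 5 :=
    hQ.tensor_mem h4 hF
  have h6 : (fun x => F (x 2) (x 1) * F (x 3) (x 1) * F (x 4) (x 0) : SpinBox X 5) ∈ Q 5 :=
    hQ.rotate_mem h5
  have h7 : (fun x => F (x 1) (x 0) * F (x 2) (x 0) * F (x 3) (x 0) : SpinBox X 4) ∈ Q 4 :=
    hQ.merge_mem 0 h6
  exact hQ.sum_mem 0 h7

/-- Four three-boxes around an internal region. -/
theorem wheel_mem (hQ : IsPlanarSubalgebra Q) {T : X → X → X → ℂ}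
    (hT : (fun x => T (x 0) (x 1) (x 2) : SpinBox X 3) ∈ Q 3) :
    (fun x => ∑ y, T y (x 0) (x 1) * T (x 1) (x 2) y * (T y (x 2) (x 3) * T (x 3) (x 0) y) :
      SpinBox X 4) ∈ Q 4 := by
  have h1 : (fun x => T (x 0) (x 1) (x 2) * T (x 3) (x 4) (x 5) : SpinBox X 6) ∈ Q 6 :=
    hQ.tensor_mem hT hT
  have h2 : (fun x => T (x 0) (x 1) (x 2) * T (x 2) (x 3) (x 4) : SpinBox X 5) ∈ Q 5 :=
    hQ.merge_mem 2 h1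
  have h3 : (fun x => T (x 1) (x 2) (x 3) * T (x 3) (x 4) (x 0) : SpinBox X 5) ∈ Q 5 :=
    hQ.rotate_mem h2
  have h4 : (fun x => T (x 0) (x 1) (x 2) * T (x 2) (x 3) (x 0) : SpinBox X 4) ∈ Q 4 :=
    hQ.merge_mem 0 h3
  -- The hub is the first region of `h4` and the last region of `h5`, so that once the rim regions
  -- between the two copies are merged the hubs are cyclically adjacent.
  have h5 : (fun x => T (x 3) (x 0) (x 1) * T (x 1) (x 2) (x 3) : SpinBox X 4) ∈ Q 4 :=
    hQ.rotate_mem (hQ.rotate_mem (hQ.rotate_mem h4))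
  have h6 : (fun x => T (x 0) (x 1) (x 2) * T (x 2) (x 3) (x 0) *
      (T (x 7) (x 4) (x 5) * T (x 5) (x 6) (x 7)) : SpinBox X 8) ∈ Q 8 := hQ.tensor_mem h4 h5
  have h7 : (fun x => T (x 0) (x 1) (x 2) * T (x 2) (x 3) (x 0) *
      (T (x 6) (x 3) (x 4) * T (x 4) (x 5) (x 6)) : SpinBox X 7) ∈ Q 7 := hQ.merge_mem 3 h6
  have h8 : (fun x => T (x 1) (x 2) (x 3) * T (x 3) (x 4) (x 1) *
      (T (x 0) (x 4) (x 5) * T (x 5) (x 6) (x 0)) : SpinBox X 7) ∈ Q 7 := hQ.rotate_mem h7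
  have h9 : (fun x => T (x 0) (x 1) (x 2) * T (x 2) (x 3) (x 0) *
      (T (x 0) (x 3) (x 4) * T (x 4) (x 5) (x 0)) : SpinBox X 6) ∈ Q 6 := hQ.merge_mem 0 h8
  have h10 : (fun x => ∑ y, T y (x 0) (x 1) * T (x 1) (x 2) y *
      (T y (x 2) (x 3) * T (x 3) (x 4) y) : SpinBox X 5) ∈ Q 5 := hQ.sum_mem 0 h9
  have h11 : (fun x => ∑ y, T y (x 1) (x 2) * T (x 2) (x 3) y *
      (T y (x 3) (x 4) * T (x 4) (x 0) y) : SpinBox X 5) ∈ Q 5 := hQ.rotate_mem h10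
  exact hQ.merge_mem 0 h11

/-- Joining two neighbouring shaded intervals and summing over the spin. -/
theorem contract_mem (hQ : IsPlanarSubalgebra Q) {n : ℕ} {f : SpinBox X (n + 2)} (k : Fin (n + 1))
    (hf : f ∈ Q (n + 2)) :
    (fun x => ∑ a : X, f (fun i => (k.insertNth a x : Fin (n + 1) → X) (k.predAbove i)) :
      SpinBox X n) ∈ Q n :=
  hQ.sum_mem k (hQ.merge_mem k hf)

theorem _root_.Fin.val_predAbove_eq {N : ℕ} (k : Fin (N + 1)) (i : Fin (N + 2)) :
    (k.predAbove i).1 = if k.1 < i.1 then i.1 - 1 else i.1 := by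
  by_cases h : k.castSucc < i
  · rw [Fin.predAbove_of_castSucc_lt _ _ h, if_pos (by exact h)]
    rfl
  · rw [Fin.predAbove_of_le_castSucc _ _ (not_lt.1 h), if_neg (by exact h)]
    rfl

omit [Finite X] [Fintype X] in
-- Explicit coordinates for `contract_mem`, reducing the bookkeeping of iterated contractions to
-- inequalities between natural numbers.
theorem _root_.Fin.insertNth_predAbove {N : ℕ} (k : Fin (N + 1)) (a : X) (x : Fin N → X)
    (i : Fin (N + 2)) : (k.insertNth a x : Fin (N + 1) → X) (k.predAbove i) =
      if h : i.1 < k.1 then x ⟨i.1, by omega⟩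
      else if h' : i.1 ≤ k.1 + 1 then a else x ⟨i.1 - 2, by omega⟩ := by
  have hv := Fin.val_predAbove_eq k i
  rcases lt_trichotomy (k.predAbove i) k with hk | hk | hk
  · rw [Fin.insertNth_apply_below hk, dif_pos (by rw [Fin.lt_def] at hk; split_ifs at hv <;> omega)]
    simp only [eq_rec_constant]
    congr 1
    ext
    rw [Fin.coe_castPred]
    rw [Fin.lt_def] at hk
    split_ifs at hv <;> omega
  · rw [Fin.ext_iff] at hk
    rw [Fin.ext hk, Fin.insertNth_apply_same, dif_neg (by split_ifs at hv <;> omega),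
      dif_pos (by split_ifs at hv <;> omega)]
  · rw [Fin.insertNth_apply_above hk, dif_neg (by rw [Fin.lt_def] at hk; split_ifs at hv <;> omega),
      dif_neg (by rw [Fin.lt_def] at hk; split_ifs at hv <;> omega)]
    simp only [eq_rec_constant]
    congr 1
    ext
    simp only [Fin.val_pred]
    rw [Fin.lt_def] at hk
    split_ifs at hv <;> omega

/-- Composing the last two regions of a box with a four-box. -/
theorem comp_mem (hQ : IsPlanarSubalgebra Q) {n : ℕ} {F : (Fin n → X) → X → X → ℂ}
    {K : X → X → X → X → ℂ}
    (hF : (fun x => F (fun i => x i.castSucc.castSucc) (x (Fin.last n).castSucc) (x (Fin.last _)) :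
      SpinBox X (n + 2)) ∈ Q (n + 2))
    (hK : (fun x => K (x 0) (x 1) (x 2) (x 3) : SpinBox X 4) ∈ Q 4) :
    (fun x => ∑ c, ∑ d, F (fun i => x i.castSucc.castSucc) c d *
      K d c (x (Fin.last n).castSucc) (x (Fin.last _)) : SpinBox X (n + 2)) ∈ Q (n + 2) := by
  have h1 := hQ.tensor_mem hF hK
  -- The contracted regions read `c d d c`: the inner pair `d` is closed first, then the outer pair
  -- `c`. This is why `K` receives its first two arguments in reversed order.
  have h2 := hQ.contract_mem (n := n + 4) ⟨n + 1, by omega⟩ h1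
  have h3 := hQ.contract_mem (n := n + 2) ⟨n, by omega⟩ h2
  convert h3 using 1
  funext x
  refine Finset.sum_congr rfl fun c _ => Finset.sum_congr rfl fun d _ => ?_
  simp only [Fin.insertNth_predAbove, Fin.val_castAdd, Fin.val_natAdd, Fin.val_castSucc,
    Fin.val_last, Fin.val_zero, Fin.val_one]
  congr 1
  · congr 1
    · funext i
      have := i.2
      rw [dif_pos (by omega), dif_pos (by omega)]
      rfl
    · rw [dif_pos (by omega), dif_neg (by omega), dif_pos (by omega)]
    · rw [dif_neg (by omega), dif_pos (by omega)]
  · have e2 : ((2 : Fin 4) : ℕ) = 2 := rfl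
    have e3 : ((3 : Fin 4) : ℕ) = 3 := rfl
    congr 1
    · rw [dif_neg (by omega), dif_pos (by omega)]
    · rw [dif_neg (by omega), dif_neg (by omega), dif_neg (by omega), dif_pos (by omega)]
    · rw [dif_neg (by omega), dif_neg (by omega), dif_neg (by omega), dif_neg (by omega)]
      congr 1
    · rw [dif_neg (by omega), dif_neg (by omega), dif_neg (by omega), dif_neg (by omega)]
      congr 1

open Classical in
/-- Multiplying a box by a two-box along its last two regions. -/
theorem mul_mem_last (hQ : IsPlanarSubalgebra Q) {n : ℕ} {F : (Fin n → X) → X → X → ℂ}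
    {R : X → X → ℂ}
    (hF : (fun x => F (fun i => x i.castSucc.castSucc) (x (Fin.last n).castSucc) (x (Fin.last _)) :
      SpinBox X (n + 2)) ∈ Q (n + 2))
    (hR : (fun x => R (x 0) (x 1) : SpinBox X 2) ∈ Q 2) :
    (fun x => R (x (Fin.last n).castSucc) (x (Fin.last _)) *
      F (fun i => x i.castSucc.castSucc) (x (Fin.last n).castSucc) (x (Fin.last _)) :
      SpinBox X (n + 2)) ∈ Q (n + 2) := by
  -- Doubling both regions of `R` gives the identity 4-box weighted by `R`; composing with it
  -- multiplies.
  have h1 : (fun x => if x 0 = x 1 then R (x 1) (x 2) else 0 : SpinBox X 3) ∈ Q 3 :=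
    hQ.split_mem 0 hR
  have h2 : (fun x => if x 2 = x 3 then if x 0 = x 1 then R (x 1) (x 3) else 0 else 0 :
      SpinBox X 4) ∈ Q 4 := hQ.split_mem 2 h1
  have h3 : (fun x => if x 3 = x 0 then if x 1 = x 2 then R (x 2) (x 0) else 0 else 0 :
      SpinBox X 4) ∈ Q 4 := hQ.rotate_mem h2
  convert hQ.comp_mem hF (K := fun a b c d => if d = a then if b = c then R c a else 0 else 0)
    h3 using 2
  simp [mul_comm]

open Classical in
/-- Exchanging the last two regions by a crossing that carries the weight `R`. -/
theorem swap_mem_last (hQ : IsPlanarSubalgebra Q) {n : ℕ} {F : (Fin n → X) → X → X → ℂ}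
    {R : X → X → ℂ}
    (hF : (fun x => F (fun i => x i.castSucc.castSucc) (x (Fin.last n).castSucc) (x (Fin.last _)) :
      SpinBox X (n + 2)) ∈ Q (n + 2))
    (hR : (fun x => if x 0 = x 2 ∧ x 1 = x 3 then R (x 0) (x 1) else 0 : SpinBox X 4) ∈ Q 4) :
    (fun x => R (x (Fin.last _)) (x (Fin.last n).castSucc) *
      F (fun i => x i.castSucc.castSucc) (x (Fin.last _)) (x (Fin.last n).castSucc) :
      SpinBox X (n + 2)) ∈ Q (n + 2) := by
  convert hQ.comp_mem hF (K := fun a b c d => if a = c ∧ b = d then R b a else 0)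
    ?_ using 2
  · simp [mul_comm, ite_and]
  · convert hQ.rotate_mem hR using 2 with x
    change _ = if x 1 = x 3 ∧ x 2 = x 0 then R (x 1) (x 2) else 0
    grind

end IsPlanarSubalgebra

/-! ### Combinatorics of pairs -/

/-- A labelling of the elements of `X` by the two-element subsets of `α`. -/
structure IsPairLabelling {α X : Type*} [DecidableEq α] (p : X → Finset α) : Prop where
  injective : Function.Injective p
  card_eq : ∀ x, (p x).card = 2
  exists_eq : ∀ a b, a ≠ b → ∃ x, p x = {a, b}

namespace IsPairLabelling

variable {α X : Type*} {p : X → Finset α}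

/-- The labels of `x` and `y` have exactly one point in common. -/
def Meets (p : X → Finset α) (x y : X) : Prop := x ≠ y ∧ ¬ Disjoint (p x) (p y)

theorem meets_comm {x y : X} : Meets p x y ↔ Meets p y x := by
  rw [Meets, Meets, disjoint_comm, ne_comm]

variable [DecidableEq α]

/-- The labels of `x`, `y`, `z` are the edges of a triangle. -/
def Tri (p : X → Finset α) (x y z : X) : Prop := symmDiff (p x) (p y) = p z

theorem tri_comm {x y z : X} : Tri p x y z ↔ Tri p y x z := by
  rw [Tri, Tri, symmDiff_comm]

/-- Symmetric difference is addition over the field with two elements, where `x + y = z` is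
symmetric in all three terms. -/
theorem tri_rotate {x y z : X} : Tri p x y z ↔ Tri p y z x := by
  constructor <;> intro h <;> unfold Tri at *
  · rw [← h, symmDiff_comm (p x), symmDiff_symmDiff_cancel_left]
  · rw [← h, symmDiff_comm (p y), symmDiff_symmDiff_cancel_right]

theorem tri_of_eq {x y z : X} {v a b : α} (hva : v ≠ a) (hvb : v ≠ b) (hab : a ≠ b)
    (hx : p x = {v, a}) (hy : p y = {v, b}) (hz : p z = {a, b}) : Tri p x y z := by
  rw [Tri, hx, hy, hz]
  ext t
  simp only [Finset.mem_symmDiff, Finset.mem_insert, Finset.mem_singleton]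
  grind

variable (hp : IsPairLabelling p)
include hp

theorem eq_pair_of_mem {x : X} {a b : α} (hab : a ≠ b) (ha : a ∈ p x) (hb : b ∈ p x) :
    p x = {a, b} := by
  symm
  apply Finset.eq_of_subset_of_card_le
  · simp [Finset.insert_subset_iff, ha, hb]
  · rw [hp.card_eq, Finset.card_pair hab]

theorem not_mem_of_mem {x : X} {a b c : α} (hab : a ≠ b) (hac : a ≠ c) (hbc : b ≠ c)
    (ha : a ∈ p x) (hb : b ∈ p x) : c ∉ p x := by
  rw [hp.eq_pair_of_mem hab ha hb]
  simp [hac.symm, hbc.symm]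

theorem tri_right_unique {x y z w : X} (h : Tri p x y z) (h' : Tri p x y w) : z = w :=
  hp.injective (h.symm.trans h')

theorem meets_iff_of_eq {x w : X} {v a : α} (hva : v ≠ a) (hx : p x = {v, a}) :
    Meets p x w ↔ (v ∈ p w ∧ a ∉ p w) ∨ (v ∉ p w ∧ a ∈ p w) := by
  have h1 : x = w ↔ v ∈ p w ∧ a ∈ p w := by
    constructor
    · rintro rfl
      simp [hx]
    · rintro ⟨h, h'⟩
      exact hp.injective (hx.trans (hp.eq_pair_of_mem hva h h').symm)
  rw [Meets, Ne, h1, hx, Finset.disjoint_left]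
  simp
  tauto

theorem exists_of_meets {x y : X} (h : Meets p x y) : ∃ v a b, v ≠ a ∧ v ≠ b ∧ a ≠ b ∧
    p x = {v, a} ∧ p y = {v, b} := by
  obtain ⟨s, t, hst, hx⟩ := Finset.card_eq_two.1 (hp.card_eq x)
  have h' := (hp.meets_iff_of_eq hst hx).1 h
  have key : ∀ v a, v ≠ a → v ∈ p y → a ∉ p y → ∃ b, v ≠ b ∧ a ≠ b ∧ p y = {v, b} := by
    intro v a hva hv ha
    obtain ⟨b, hb, hbv⟩ := Finset.exists_mem_ne (by rw [hp.card_eq y]; norm_num) v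
    refine ⟨b, hbv.symm, ?_, hp.eq_pair_of_mem hbv.symm hv hb⟩
    rintro rfl
    exact ha hb
  rcases h' with ⟨h1, h2⟩ | ⟨h1, h2⟩
  · obtain ⟨b, hb, hb', hy⟩ := key s t hst h1 h2
    exact ⟨s, t, b, hst, hb, hb', hx, hy⟩
  · obtain ⟨b, hb, hb', hy⟩ := key t s hst.symm h2 h1
    exact ⟨t, s, b, hst.symm, hb, hb', by rw [hx, Finset.pair_comm], hy⟩

theorem meets_iff_exists_tri {x y : X} : Meets p x y ↔ ∃ z, Tri p x y z := by
  constructor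
  · intro h
    obtain ⟨v, a, b, hva, hvb, hab, hx, hy⟩ := hp.exists_of_meets h
    obtain ⟨z, hz⟩ := hp.exists_eq a b hab
    exact ⟨z, tri_of_eq hva hvb hab hx hy hz⟩
  · rintro ⟨z, hz⟩
    refine ⟨?_, fun hd => ?_⟩
    · rintro rfl
      have := hp.card_eq z
      rw [← hz] at this
      simp at this
    · have := hp.card_eq z
      rw [← hz, hd.symmDiff_eq_sup, Finset.sup_eq_union, Finset.card_union_of_disjoint hd,
        hp.card_eq, hp.card_eq] at this
      omega

theorem meets_of_tri {x y z : X} (h : Tri p x y z) : Meets p x y :=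
  hp.meets_iff_exists_tri.2 ⟨z, h⟩

open Classical in
-- Three pairwise meeting edges, with `x` and `y` distinct from `z` and from each other, form a
-- triangle or a star. This count tells the two apart as soon as there are more than four points.
theorem sum_tripod [Fintype α] [Fintype X] {x y z : X} (hxy : Meets p x y) (hyz : Meets p y z)
    (hxz : Meets p x z) :
    (∑ w, (if Meets p x w then 1 else 0) * (if Meets p y w then 1 else 0) *
      (if Meets p z w then 1 else 0) : ℂ) =
      if Tri p x y z then 0 else (Fintype.card α : ℂ) - 4 := by
  obtain ⟨v, a, b, hva, hvb, hab, hx, hy⟩ := hp.exists_of_meets hxy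
  have hmx := fun w => hp.meets_iff_of_eq (w := w) hva hx
  have hmy := fun w => hp.meets_iff_of_eq (w := w) hvb hy
  have e : ∀ w, ((if Meets p x w then 1 else 0) * (if Meets p y w then 1 else 0) *
      (if Meets p z w then 1 else 0) : ℂ) =
      if Meets p x w ∧ Meets p y w ∧ Meets p z w then 1 else 0 := by
    intro w
    by_cases h1 : Meets p x w <;> by_cases h2 : Meets p y w <;> by_cases h3 : Meets p z w <;>
      simp [h1, h2, h3]
  simp only [e, Finset.sum_boole]
  by_cases hz : v ∈ p z
  · obtain ⟨c, hc, hcv⟩ := Finset.exists_mem_ne (by rw [hp.card_eq z]; norm_num) v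
    have hz' := hp.eq_pair_of_mem hcv.symm hz hc
    have hmz := fun w => hp.meets_iff_of_eq (w := w) hcv.symm hz'
    have hca : c ≠ a := by
      rintro rfl
      exact hxz.1 (hp.injective (hx.trans hz'.symm))
    have hcb : c ≠ b := by
      rintro rfl
      exact hyz.1 (hp.injective (hy.trans hz'.symm))
    have ht : ¬ Tri p x y z := by
      intro h
      have : v ∈ symmDiff (p x) (p y) := by rw [h]; exact hz
      simp [Finset.mem_symmDiff, hx, hy] at this
    rw [if_neg ht]
    -- In a star with centre `v` and leaves `a`, `b`, `c`, an edge that avoids `v` would have to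
    -- contain all three leaves. So the edges counted are `{v, d}` with `d` a new point.
    have hcard : ({v, a, b, c} : Finset α)ᶜ.card =
        (Finset.univ.filter fun w => Meets p x w ∧ Meets p y w ∧ Meets p z w).card := by
      have hmk : ∀ d ∈ ({v, a, b, c} : Finset α)ᶜ, ∃ w, p w = {v, d} := by
        intro d hd
        apply hp.exists_eq
        rintro rfl
        simp at hd
      have : Nonempty X := ⟨x⟩
      choose! mk hmk using hmk
      refine Finset.card_bij (fun d _ => mk d) ?_ ?_ ?_
      · intro d hd
        have := hmk d hd
        simp only [Finset.mem_compl, Finset.mem_insert, Finset.mem_singleton] at hd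
        simp only [Finset.mem_filter, Finset.mem_univ, true_and, hmx, hmy, hmz, this,
          Finset.mem_insert, Finset.mem_singleton]
        grind
      · intro d hd d' hd' h
        have h1 : d ∈ p (mk d') := by
          rw [← h, hmk d hd]
          simp
        rw [hmk d' hd'] at h1
        simp at hd h1
        tauto
      · intro w hw
        simp only [Finset.mem_filter, Finset.mem_univ, true_and, hmx, hmy, hmz] at hw
        have hvw : v ∈ p w := by
          by_contra hv
          have := hp.not_mem_of_mem hab hca.symm hcb.symm (x := w)
          tauto
        obtain ⟨d, hd, hdv⟩ := Finset.exists_mem_ne (by rw [hp.card_eq w]; norm_num) v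
        have hw' := hp.eq_pair_of_mem hdv.symm hvw hd
        have hd' : d ∈ ({v, a, b, c} : Finset α)ᶜ := by
          simp only [Finset.mem_compl, Finset.mem_insert, Finset.mem_singleton]
          rintro (rfl | rfl | rfl | rfl) <;> tauto
        exact ⟨d, hd', hp.injective ((hmk d hd').trans hw'.symm)⟩
    rw [← hcard, Finset.card_compl, Nat.cast_sub (Finset.card_le_univ _)]
    congr 1
    rw [Finset.card_insert_of_notMem, Finset.card_insert_of_notMem, Finset.card_pair hcb.symm]
    · norm_num
    · simp [hab, hca.symm]
    · simp [hva, hvb, hcv.symm]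
  · have ha : a ∈ p z := by have := (hmx z).1 hxz; tauto
    have hb : b ∈ p z := by have := (hmy z).1 hyz; tauto
    have hz' := hp.eq_pair_of_mem hab ha hb
    have hmz := fun w => hp.meets_iff_of_eq (w := w) hab hz'
    rw [if_pos (tri_of_eq hva hvb hab hx hy hz')]
    -- Parity: no set contains exactly one point of each edge of a triangle.
    simp only [hmx, hmy, hmz, Nat.cast_eq_zero, Finset.card_eq_zero, Finset.filter_eq_empty_iff]
    intro w _ h
    tauto

open Classical in
-- The apex of a triangle on `x` whose other two sides meet `w` must be one of the two points of
-- `w`, and the two sides can be ordered in two ways. The value only has to be nonzero and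
-- independent of the disjoint pair.
theorem sum_tri_meets [Fintype X] {x w : X} (hd : Disjoint (p x) (p w)) :
    (∑ y, ∑ z, (if Tri p x y z then 1 else 0) * ((if Meets p y w then 1 else 0) *
      (if Meets p z w then 1 else 0)) : ℂ) = 4 := by
  obtain ⟨a, b, hab, hx⟩ := Finset.card_eq_two.1 (hp.card_eq x)
  obtain ⟨c, d, hcd, hw⟩ := Finset.card_eq_two.1 (hp.card_eq w)
  rw [hx, hw] at hd
  simp only [Finset.disjoint_insert_left, Finset.disjoint_singleton_left, Finset.mem_insert,
    Finset.mem_singleton, not_or] at hd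
  simp only [← ne_eq] at hd
  obtain ⟨⟨hac, had⟩, hbc, hbd⟩ := hd
  have hmw := fun w => hp.meets_iff_of_eq (w := w) hcd hw
  have hmx := fun w => hp.meets_iff_of_eq (w := w) hab hx
  have hx' : p x = {b, a} := by rw [hx, Finset.pair_comm]
  obtain ⟨ac, hac'⟩ := hp.exists_eq a c hac
  obtain ⟨ad, had'⟩ := hp.exists_eq a d had
  obtain ⟨bc, hbc'⟩ := hp.exists_eq b c hbc
  obtain ⟨bd, hbd'⟩ := hp.exists_eq b d hbd
  have t1 : Tri p x ac bc := tri_of_eq hab hac hbc hx hac' hbc'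
  have t2 : Tri p x ad bd := tri_of_eq hab had hbd hx had' hbd'
  have t3 : Tri p x bc ac := tri_of_eq hab.symm hbc hac hx' hbc' hac'
  have t4 : Tri p x bd ad := tri_of_eq hab.symm hbd had hx' hbd' had'
  have m1 : Meets p ac w := by rw [meets_comm, hmw]; simp [hac', hac.symm, had.symm, hcd.symm]
  have m2 : Meets p ad w := by rw [meets_comm, hmw]; simp [had', hac.symm, had.symm, hcd]
  have m3 : Meets p bc w := by rw [meets_comm, hmw]; simp [hbc', hbc.symm, hbd.symm, hcd.symm]
  have m4 : Meets p bd w := by rw [meets_comm, hmw]; simp [hbd', hbc.symm, hbd.symm, hcd]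
  have hiff : ∀ q : X × X, (Tri p x q.1 q.2 ∧ Meets p q.1 w ∧ Meets p q.2 w) ↔
      q ∈ ({(ac, bc), (ad, bd), (bc, ac), (bd, ad)} : Finset (X × X)) := by
    rintro ⟨y, z⟩
    simp only [Finset.mem_insert, Finset.mem_singleton, Prod.mk.injEq]
    constructor
    · rintro ⟨h, hy, hz⟩
      have hxy := (hmx y).1 (hp.meets_of_tri h)
      rw [meets_comm, hmw] at hy
      have key : ∀ {s t u r}, p u = {s, t} → s ≠ t → s ∈ p y → t ∈ p y → Tri p x u r →
          y = u ∧ z = r := by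
        intro s t u r hu hst hs ht htri
        have hyu : y = u := hp.injective ((hp.eq_pair_of_mem hst hs ht).trans hu.symm)
        subst hyu
        exact ⟨rfl, hp.tri_right_unique h htri⟩
      rcases hxy with ⟨h1, -⟩ | ⟨-, h1⟩ <;> rcases hy with ⟨h2, -⟩ | ⟨-, h2⟩
      · exact Or.inl (key hac' hac h1 h2 t1)
      · exact Or.inr (Or.inl (key had' had h1 h2 t2))
      · exact Or.inr (Or.inr (Or.inl (key hbc' hbc h1 h2 t3)))
      · exact Or.inr (Or.inr (Or.inr (key hbd' hbd h1 h2 t4)))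
    · rintro (⟨rfl, rfl⟩ | ⟨rfl, rfl⟩ | ⟨rfl, rfl⟩ | ⟨rfl, rfl⟩) <;> tauto
  have e : ∀ y z, ((if Tri p x y z then 1 else 0) * ((if Meets p y w then 1 else 0) *
      (if Meets p z w then 1 else 0)) : ℂ) =
      if (y, z) ∈ ({(ac, bc), (ad, bd), (bc, ac), (bd, ad)} : Finset (X × X)) then 1 else 0 := by
    intro y z
    simp only [← hiff]
    by_cases h1 : Tri p x y z <;> by_cases h2 : Meets p y w <;> by_cases h3 : Meets p z w <;>
      simp [h1, h2, h3]
  simp only [e]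
  rw [← Fintype.sum_prod_type' (f := fun y z =>
    if (y, z) ∈ ({(ac, bc), (ad, bd), (bc, ac), (bd, ad)} : Finset (X × X)) then (1 : ℂ) else 0)]
  simp only [Finset.sum_boole, Prod.mk.eta, Finset.filter_univ_mem]
  have n1 : ac ≠ ad := by
    rintro rfl
    have : c ∈ ({a, d} : Finset α) := by rw [← had', hac']; simp
    simp [hac.symm, hcd] at this
  have n2 : ac ≠ bc := (hp.meets_of_tri (tri_rotate.1 t1)).1
  have n3 : ac ≠ bd := by
    rintro rfl
    have : c ∈ ({b, d} : Finset α) := by rw [← hbd', hac']; simp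
    simp [hbc.symm, hcd] at this
  have n4 : ad ≠ bc := by
    rintro rfl
    have : d ∈ ({b, c} : Finset α) := by rw [← hbc', had']; simp
    simp [hbd.symm, hcd.symm] at this
  have n5 : ad ≠ bd := (hp.meets_of_tri (tri_rotate.1 t2)).1
  have n6 : bc ≠ bd := by
    rintro rfl
    have : c ∈ ({b, d} : Finset α) := by rw [← hbd', hbc']; simp
    simp [hbc.symm, hcd] at this
  rw [Finset.card_insert_of_notMem, Finset.card_insert_of_notMem, Finset.card_pair]
  · norm_num
  · simp [n6]
  · simp [n4, n5]
  · simp [n1, n2, n3]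

/-! ### Reconstructing a permutation of the points -/

/-- A map that preserves and reflects disjointness of labels comes from a permutation of the
points. The hypotheses on `s` say that all of its cycles have length at least five. -/
theorem exists_perm [Finite α] (s : Equiv.Perm α) (h1 : ∀ a, s a ≠ a) (h2 : ∀ a, s (s a) ≠ a)
    (h3 : ∀ a, s (s (s a)) ≠ a) (h4 : ∀ a, s (s (s (s a))) ≠ a) {φ : X → X}
    (hφ : ∀ x y, Disjoint (p (φ x)) (p (φ y)) ↔ Disjoint (p x) (p y)) :
    ∃ π : Equiv.Perm α, ∀ x, p (φ x) = (p x).map π.toEmbedding := by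
  -- The edges `{a, s a}` form disjoint cycles. The image of a point is read off as the common point
  -- of the images of the two cycle edges at it: `f a` is the image of `s a`.
  choose e he using fun a => hp.exists_eq a (s a) (h1 a).symm
  have hdis : ∀ a b, Disjoint (p (e a)) (p (e b)) ↔ a ≠ b ∧ b ≠ s a ∧ a ≠ s b := by
    intro a b
    rw [he, he]
    simp only [Finset.disjoint_insert_left, Finset.disjoint_singleton_left, Finset.mem_insert,
      Finset.mem_singleton, not_or, s.injective.eq_iff]
    tauto
  have hex : ∀ a, ∃ t, t ∈ p (φ (e a)) ∧ t ∈ p (φ (e (s a))) := by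
    intro a
    apply Finset.not_disjoint_iff.1
    rw [hφ, hdis]
    simp
  choose f hf using hex
  have hinj : Function.Injective f := by
    -- If `f a = f (s a)`, the images of the edges starting at `a` and at `s (s a)` share a point,
    -- although these edges are disjoint.
    have key : ∀ a, f a ≠ f (s a) := by
      intro a h
      have hd := (hdis a (s (s a))).2 ⟨(h2 a).symm, h1 _, (h3 a).symm⟩
      rw [← hφ] at hd
      refine Finset.disjoint_left.1 hd (hf a).1 ?_
      rw [h]
      exact (hf (s a)).2
    intro a b h
    by_contra hab
    have hnd : ¬ Disjoint (p (φ (e a))) (p (φ (e b))) :=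
      Finset.not_disjoint_iff.2 ⟨f a, (hf a).1, h ▸ (hf b).1⟩
    rw [hφ, hdis] at hnd
    by_cases hb : b = s a
    · exact key a (hb ▸ h)
    · by_cases ha : a = s b
      · exact key b (ha ▸ h.symm)
      · exact hnd ⟨hab, hb, ha⟩
  have hbij : Function.Bijective (f ∘ s.symm) :=
    Finite.injective_iff_bijective.1 (hinj.comp s.symm.injective)
  let π : Equiv.Perm α := Equiv.ofBijective _ hbij
  have hπ : ∀ a, π (s a) = f a := fun a => by simp [π]
  have hπe : ∀ a t, t ∈ p (φ (e a)) ↔ t = π a ∨ t = π (s a) := by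
    intro a t
    have hm : π a ∈ p (φ (e a)) := by
      obtain ⟨b, rfl⟩ := s.surjective a
      rw [hπ]
      exact (hf b).2
    have hm' : π (s a) ∈ p (φ (e a)) := by
      rw [hπ]
      exact (hf a).1
    rw [hp.eq_pair_of_mem (π.injective.ne (h1 a).symm) hm hm']
    simp
  have hmeet : ∀ a x, (a ∈ p x ∨ s a ∈ p x) ↔ (π a ∈ p (φ x) ∨ π (s a) ∈ p (φ x)) := by
    intro a x
    have := hφ (e a) x
    rw [← not_iff_not, Finset.not_disjoint_iff, Finset.not_disjoint_iff] at this
    simp only [hπe, he, Finset.mem_insert, Finset.mem_singleton, or_and_right, exists_or,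
      exists_eq_left] at this
    exact this.symm
  refine ⟨π, fun x => ?_⟩
  symm
  apply Finset.eq_of_subset_of_card_le
  · intro t ht
    obtain ⟨a, ha, rfl⟩ := Finset.mem_map.1 ht
    change π a ∈ p (φ x)
    by_contra hna
    -- Write the point as `s (s c)`. If its image is missing from the label of `φ x`, then `hmeet`
    -- puts the images of its neighbours `s c` and `s (s (s c))` there. Applying `hmeet` backwards
    -- to the next cycle edges gives `p x` one of `c`, `s c` and one of `s³ c`, `s⁴ c`, hence three
    -- distinct points.
    obtain ⟨b, rfl⟩ := s.surjective a
    obtain ⟨c, rfl⟩ := s.surjective b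
    have hb : π (s c) ∈ p (φ x) := by
      have := (hmeet (s c) x).1 (Or.inr ha)
      tauto
    have hd : π (s (s (s c))) ∈ p (φ x) := by
      have := (hmeet (s (s c)) x).1 (Or.inl ha)
      tauto
    have k1 := (hmeet c x).2 (Or.inr hb)
    have k2 := (hmeet (s (s (s c))) x).2 (Or.inl hd)
    have g : ∀ u v, u ≠ v → s (s c) ≠ u → s (s c) ≠ v → u ∈ p x → v ∉ p x := by
      intro u v huv hu hv hux
      exact hp.not_mem_of_mem hu hv huv ha hux
    have i1 := h1 (s c)
    have i2 := h2 c
    have i3 := h2 (s c)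
    have i4 := h3 c
    have i5 := h3 (s c)
    have i6 := h4 c
    have i7 := h1 (s (s c))
    have i8 := h2 (s (s c))
    rcases k1 with k1 | k1 <;> rcases k2 with k2 | k2
    · exact g _ _ i4.symm i2 i7.symm k1 k2
    · exact g _ _ i6.symm i2 i8.symm k1 k2
    · exact g _ _ i3.symm i1 i7.symm k1 k2
    · exact g _ _ i5.symm i1 i8.symm k1 k2
  · rw [Finset.card_map, hp.card_eq, hp.card_eq]

end IsPairLabelling

/-! ### Construction of the crossing -/

namespace IsPlanarSubalgebra

variable {X : Type*} [Fintype X] {Q : ∀ n, Submodule ℂ (SpinBox X n)}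

/-- Any two of three regions are cyclically adjacent, so rotations bring each pair to the end, where
`mul_mem_last` applies. -/
theorem mul_boundary_mem (hQ : IsPlanarSubalgebra Q) {R : X → X → ℂ} {G : X → X → X → ℂ}
    (hR : (fun x => R (x 0) (x 1) : SpinBox X 2) ∈ Q 2)
    (hG : (fun x => G (x 0) (x 1) (x 2) : SpinBox X 3) ∈ Q 3) :
    (fun x => R (x 1) (x 2) * (R (x 2) (x 0) * (R (x 0) (x 1) * G (x 0) (x 1) (x 2))) :
      SpinBox X 3) ∈ Q 3 := by
  have h2 : (fun x => R (x 1) (x 2) * G (x 1) (x 2) (x 0) : SpinBox X 3) ∈ Q 3 :=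
    hQ.mul_mem_last (n := 1) (F := fun u a b => G a b (u 0)) (hQ.rotate_mem hG) hR
  have h3 : (fun x => R (x 0) (x 1) * G (x 0) (x 1) (x 2) : SpinBox X 3) ∈ Q 3 :=
    hQ.rotate_mem (hQ.rotate_mem h2)
  have h4 : (fun x => R (x 1) (x 2) * (R (x 2) (x 0) * G (x 2) (x 0) (x 1)) :
      SpinBox X 3) ∈ Q 3 :=
    hQ.mul_mem_last (n := 1) (F := fun u a b => R b (u 0) * G b (u 0) a)
      (hQ.rotate_mem (hQ.rotate_mem h3)) hR
  have h5 : (fun x => R (x 2) (x 0) * (R (x 0) (x 1) * G (x 0) (x 1) (x 2)) :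
      SpinBox X 3) ∈ Q 3 := hQ.rotate_mem h4
  exact hQ.mul_mem_last (n := 1) (F := fun u a b => R b (u 0) * (R (u 0) a * G (u 0) a b)) h5 hR

open Classical in
theorem diagonal_four_mem (hQ : IsPlanarSubalgebra Q) :
    (fun x => if x 0 = x 1 then if x 1 = x 2 then if x 2 = x 3 then 1 else 0 else 0 else 0 :
      SpinBox X 4) ∈ Q 4 := by
  have h1 : (fun x => if x 0 = x 1 then if x 1 = x 2 then 1 else 0 else 0 :
      SpinBox X 3) ∈ Q 3 := hQ.split_mem 0 hQ.delta_mem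
  exact hQ.split_mem 0 h1

end IsPlanarSubalgebra

namespace IsPairLabelling

open IsPlanarSubalgebra

variable {α X : Type*} [DecidableEq α] {p : X → Finset α}

theorem trichotomy (hp : IsPairLabelling p) (x y : X) :
    (x = y ∧ ¬ Meets p x y ∧ ¬ Disjoint (p x) (p y)) ∨
    (x ≠ y ∧ Meets p x y ∧ ¬ Disjoint (p x) (p y)) ∨
    (x ≠ y ∧ ¬ Meets p x y ∧ Disjoint (p x) (p y)) := by
  have h : x = y → ¬ Disjoint (p x) (p y) := by
    rintro rfl h
    have := hp.card_eq x
    rw [disjoint_self.1 h] at this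
    simp at this
  unfold Meets
  tauto

variable [Fintype X] {Q : ∀ n, Submodule ℂ (SpinBox X n)}

open Classical in
theorem meets_mem (hp : IsPairLabelling p) (hQ : IsPlanarSubalgebra Q)
    (hD : (fun x => if Disjoint (p (x 0)) (p (x 1)) then 1 else 0 : SpinBox X 2) ∈ Q 2) :
    (fun x => if Meets p (x 0) (x 1) then 1 else 0 : SpinBox X 2) ∈ Q 2 := by
  convert (Q 2).sub_mem ((Q 2).sub_mem hQ.one_mem_two hQ.delta_mem) hD using 1
  funext x
  simp only [Pi.sub_apply]
  rcases hp.trichotomy (x 0) (x 1) with h | h | h <;>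
    simp only [h.2, if_true, if_false] <;> simp [h.1]

open Classical in
-- On pairwise meeting triples the normalised tripod sum is the indicator of stars; its complement,
-- cut down to such triples, is the triangle relation.
theorem tri_mem [Fintype α] (hα : 5 ≤ Fintype.card α) (hp : IsPairLabelling p)
    (hQ : IsPlanarSubalgebra Q)
    (hD : (fun x => if Disjoint (p (x 0)) (p (x 1)) then 1 else 0 : SpinBox X 2) ∈ Q 2) :
    (fun x => if Tri p (x 0) (x 1) (x 2) then 1 else 0 : SpinBox X 3) ∈ Q 3 := by
  have hB := hp.meets_mem hQ hD
  have hc : ((Fintype.card α : ℂ) - 4) ≠ 0 := by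
    rw [sub_ne_zero]
    exact_mod_cast (show Fintype.card α ≠ 4 by omega)
  have h1 : (fun _ => 1 : SpinBox X 3) ∈ Q 3 := hQ.cup_mem 0 hQ.one_mem_two
  have h2 := hQ.tripod_mem (F := fun a b => if Meets p a b then 1 else 0) hB
  have h3 := (Q 3).sub_mem h1 ((Q 3).smul_mem ((Fintype.card α : ℂ) - 4)⁻¹ h2)
  have h4 := hQ.mul_boundary_mem (R := fun a b => if Meets p a b then 1 else 0)
    (G := fun a b c => 1 - ((Fintype.card α : ℂ) - 4)⁻¹ * ∑ y, (if Meets p a y then 1 else 0) *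
      (if Meets p b y then 1 else 0) * (if Meets p c y then 1 else 0)) hB h3
  convert h4 using 1
  funext x
  by_cases h01 : Meets p (x 0) (x 1)
  · by_cases h12 : Meets p (x 1) (x 2)
    · by_cases h20 : Meets p (x 2) (x 0)
      · rw [if_pos h01, if_pos h12, if_pos h20, hp.sum_tripod h01 h12 (meets_comm.1 h20)]
        split_ifs <;> simp [hc]
      · rw [if_neg h20, if_neg (fun h => h20 (hp.meets_of_tri (tri_rotate.1 (tri_rotate.1 h))))]
        simp
    · rw [if_neg h12, if_neg (fun h => h12 (hp.meets_of_tri (tri_rotate.1 h)))]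
      simp
  · rw [if_neg h01, if_neg (fun h => h01 (hp.meets_of_tri h))]
    simp

open Classical in
-- In a wheel of four triangles with hub `y`, consecutive triangles share two edges, so opposite rim
-- edges coincide. The hub is then the unique third edge, which exists exactly when the rim edges
-- meet.
theorem crossing_meets_mem [Fintype α] (hα : 5 ≤ Fintype.card α) (hp : IsPairLabelling p)
    (hQ : IsPlanarSubalgebra Q)
    (hD : (fun x => if Disjoint (p (x 0)) (p (x 1)) then 1 else 0 : SpinBox X 2) ∈ Q 2) :
    (fun x => if x 0 = x 2 ∧ x 1 = x 3 then if Meets p (x 0) (x 1) then 1 else 0 else 0 :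
      SpinBox X 4) ∈ Q 4 := by
  convert hQ.wheel_mem (T := fun a b c => if Tri p a b c then 1 else 0)
    (hp.tri_mem hα hQ hD) using 1
  funext x
  have hT : ∀ y, ((if Tri p y (x 0) (x 1) then 1 else 0) * (if Tri p (x 1) (x 2) y then 1 else 0) *
      ((if Tri p y (x 2) (x 3) then 1 else 0) * (if Tri p (x 3) (x 0) y then 1 else 0)) : ℂ) =
      if Tri p (x 0) (x 1) y ∧ x 0 = x 2 ∧ x 1 = x 3 then 1 else 0 := by
    intro y
    simp only [← ite_and, ite_mul, one_mul, zero_mul]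
    refine if_congr ?_ rfl rfl
    constructor
    · rintro ⟨⟨h1, h2⟩, h3, h4⟩
      refine ⟨tri_rotate.1 h1, ?_, ?_⟩
      · exact hp.tri_right_unique (tri_rotate.1 (tri_rotate.1 h1)) (tri_rotate.1 (tri_comm.1 h2))
      · exact hp.tri_right_unique h1 (tri_comm.1 (tri_rotate.1 h4))
    · rintro ⟨h, h1, h2⟩
      rw [← h1, ← h2]
      exact ⟨⟨tri_rotate.2 h, tri_comm.1 h⟩, tri_rotate.2 h, tri_comm.1 h⟩
  simp only [hT]
  by_cases h : x 0 = x 2 ∧ x 1 = x 3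
  · by_cases hm : Meets p (x 0) (x 1)
    · obtain ⟨z, hz⟩ := hp.meets_iff_exists_tri.1 hm
      rw [if_pos h, if_pos hm, Finset.sum_eq_single z, if_pos ⟨hz, h⟩]
      · intro y _ hy
        rw [if_neg]
        rintro ⟨h', -⟩
        exact hy (hp.tri_right_unique h' hz)
      · simp
    · rw [if_pos h, if_neg hm, Finset.sum_eq_zero]
      intro y _
      rw [if_neg]
      rintro ⟨h', -⟩
      exact hm (hp.meets_of_tri h')
  · simp [h]

open Classical in
-- The strand of `x₁` is replaced by a bigon of two triangles with sides `c`, `d`, and the strand of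
-- `x₀` is pulled across both sides by the weighted crossing. The bigon forces `x₁ = x₃`, and for
-- disjoint labels it is counted by `sum_tri_meets`.
theorem crossing_disjoint_mem [Fintype α] (hα : 5 ≤ Fintype.card α) (hp : IsPairLabelling p)
    (hQ : IsPlanarSubalgebra Q)
    (hD : (fun x => if Disjoint (p (x 0)) (p (x 1)) then 1 else 0 : SpinBox X 2) ∈ Q 2) :
    (fun x => if x 0 = x 2 ∧ x 1 = x 3 then if Disjoint (p (x 0)) (p (x 1)) then 1 else 0 else 0 :
      SpinBox X 4) ∈ Q 4 := by
  have hT := hp.tri_mem hα hQ hD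
  have hR := hp.crossing_meets_mem hα hQ hD
  let T : X → X → X → ℂ := fun a b c => if Tri p a b c then 1 else 0
  let R : X → X → ℂ := fun a b => if Meets p a b then 1 else 0
  let δ : X → X → ℂ := fun a b => if a = b then 1 else 0
  have h1 : (fun x => δ (x 0) (x 1) * T (x 2) (x 3) (x 4) : SpinBox X 5) ∈ Q 5 :=
    hQ.tensor_mem hQ.delta_mem hT
  have h2 : (fun x => δ (x 2) (x 3) * T (x 4) (x 0) (x 1) : SpinBox X 5) ∈ Q 5 :=
    hQ.rotate_mem (hQ.rotate_mem h1)
  -- The strand `δ` passes one leg of the triangle here and a second leg in `h5`, and then separates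
  -- the third leg from these two.
  have h3 : (fun x => R (x 4) (x 3) * (δ (x 2) (x 4) * T (x 3) (x 0) (x 1)) : SpinBox X 5) ∈ Q 5 :=
    hQ.swap_mem_last (n := 3) (F := fun u a b => δ (u 2) a * T b (u 0) (u 1)) h2 hR
  have h4 : (fun x => R (x 3) (x 2) * (δ (x 1) (x 3) * T (x 2) (x 4) (x 0)) : SpinBox X 5) ∈ Q 5 :=
    hQ.rotate_mem (hQ.rotate_mem (hQ.rotate_mem (hQ.rotate_mem h3)))
  have h5 : (fun x => R (x 4) (x 3) * (R (x 4) (x 2) * (δ (x 1) (x 4) * T (x 2) (x 3) (x 0))) :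
      SpinBox X 5) ∈ Q 5 :=
    hQ.swap_mem_last (n := 3) (F := fun u a b => R a (u 2) * (δ (u 1) a * T (u 2) b (u 0))) h4 hR
  have h6 : (fun x => R (x 0) (x 4) * (R (x 0) (x 3) * (δ (x 2) (x 0) * T (x 3) (x 4) (x 1))) :
      SpinBox X 5) ∈ Q 5 := hQ.rotate_mem h5
  -- The closing triangle gets a doubled region because `comp_mem` takes a 4-box; the merge in `h8`
  -- removes the doubling.
  have hK : (fun x => if x 2 = x 3 then T (x 0) (x 1) (x 3) else 0 : SpinBox X 4) ∈ Q 4 :=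
    hQ.split_mem 2 hT
  have h7 : (fun x => ∑ c, ∑ d, R (x 0) d * (R (x 0) c * (δ (x 2) (x 0) * T c d (x 1))) *
      (if x 3 = x 4 then T d c (x 4) else 0) : SpinBox X 5) ∈ Q 5 :=
    hQ.comp_mem (n := 3) (F := fun u a b => R (u 0) b * (R (u 0) a * (δ (u 2) (u 0) * T a b (u 1))))
      (K := fun d c a b => if a = b then T d c b else 0) h6 hK
  have h8 : (fun x => ∑ c, ∑ d, R (x 0) d * (R (x 0) c * (δ (x 2) (x 0) * T c d (x 1))) *
      (if x 3 = x 3 then T d c (x 3) else 0) : SpinBox X 4) ∈ Q 4 := hQ.merge_mem 3 h7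
  have h9 := hQ.mul_mem_last (n := 2) (R := fun a b => if Disjoint (p a) (p b) then 1 else 0)
    (F := fun u a b => ∑ c, ∑ d, R (u 0) d * (R (u 0) c * (δ a (u 0) * T c d (u 1))) *
      (if b = b then T d c b else 0)) h8 hD
  -- The factor `4` is the bigon count of `sum_tri_meets`.
  convert (Q 4).smul_mem (4 : ℂ)⁻¹ h9 using 1
  funext x
  change _ = (4 : ℂ)⁻¹ * ((if Disjoint (p (x 2)) (p (x 3)) then 1 else 0) *
    ∑ c, ∑ d, R (x 0) d * (R (x 0) c * (δ (x 2) (x 0) * T c d (x 1))) *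
      (if x 3 = x 3 then T d c (x 3) else 0))
  have key : ∀ c d, R (x 0) d * (R (x 0) c * (δ (x 2) (x 0) * T c d (x 1))) *
      (if x 3 = x 3 then T d c (x 3) else 0) = if x 0 = x 2 ∧ x 1 = x 3 then
        (if Tri p (x 1) c d then 1 else 0) * ((if Meets p c (x 0) then 1 else 0) *
          (if Meets p d (x 0) then 1 else 0)) else 0 := by
    intro c d
    have e1 : x 1 ≠ x 3 → T c d (x 1) * T d c (x 3) = 0 := by
      intro h
      by_cases h1 : Tri p c d (x 1)
      · rw [show T d c (x 3) = 0 from if_neg fun h2 => h (hp.tri_right_unique h1 (tri_comm.1 h2))]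
        simp
      · rw [show T c d (x 1) = 0 from if_neg h1]
        simp
    have e2 : T c d (x 1) * T d c (x 1) = if Tri p (x 1) c d then 1 else 0 := by
      simp only [T, tri_comm (x := d), tri_rotate (x := x 1)]
      simp
    rw [if_pos rfl]
    by_cases h1 : x 1 = x 3
    · rw [← h1]
      by_cases h0 : x 0 = x 2
      · rw [if_pos ⟨h0, rfl⟩, ← e2, show δ (x 2) (x 0) = 1 from if_pos h0.symm]
        simp only [R, meets_comm (x := x 0)]
        ring
      · rw [if_neg (fun h => h0 h.1), show δ (x 2) (x 0) = 0 from if_neg (Ne.symm h0)]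
        ring
    · rw [if_neg (fun h => h1 h.2)]
      linear_combination (R (x 0) d * R (x 0) c * δ (x 2) (x 0)) * e1 h1
  rw [Finset.sum_congr rfl fun c _ => Finset.sum_congr rfl fun d _ => key c d]
  by_cases h : x 0 = x 2 ∧ x 1 = x 3
  · simp only [if_pos h]
    rw [← h.1, ← h.2]
    by_cases hd : Disjoint (p (x 0)) (p (x 1))
    · rw [hp.sum_tri_meets hd.symm, if_pos hd]
      norm_num
    · simp [hd]
  · simp [h]

open Classical in
-- Two labels are equal, meeting or disjoint; the crossing is the sum of its restrictions to the
-- three cases.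
theorem crossing_mem [Fintype α] (hα : 5 ≤ Fintype.card α) (hp : IsPairLabelling p)
    (hQ : IsPlanarSubalgebra Q)
    (hD : (fun x => if Disjoint (p (x 0)) (p (x 1)) then 1 else 0 : SpinBox X 2) ∈ Q 2) :
    (fun x => if x 0 = x 2 ∧ x 1 = x 3 then 1 else 0 : SpinBox X 4) ∈ Q 4 := by
  convert (Q 4).add_mem ((Q 4).add_mem hQ.diagonal_four_mem (hp.crossing_meets_mem hα hQ hD))
    (hp.crossing_disjoint_mem hα hQ hD) using 1
  funext x
  simp only [Pi.add_apply]
  by_cases h : x 0 = x 2 ∧ x 1 = x 3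
  · rw [if_pos h, if_pos h, if_pos h, ← h.1, ← h.2]
    rcases hp.trichotomy (x 0) (x 1) with h' | h' | h' <;>
      simp only [h'.2, if_true, if_false] <;> simp [h'.1]
  · rw [if_neg h, if_neg h, if_neg h]
    split_ifs <;> simp
    grind

end IsPairLabelling

/-! ### Planar subalgebras with a crossing -/

theorem Fin.exists_perm_comp_eq {m n : ℕ} {φ ψ : Fin m → Fin n} (hφ : Function.Injective φ)
    (hψ : Function.Injective ψ) : ∃ π : Equiv.Perm (Fin n), ∀ i, π (φ i) = ψ i := by
  classical
  let e : {x // x ∈ Set.range φ} ≃ {x // x ∈ Set.range ψ} :=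
    (Equiv.ofInjective φ hφ).symm.trans (Equiv.ofInjective ψ hψ)
  refine ⟨e.extendSubtype, fun i => ?_⟩
  rw [Equiv.extendSubtype_apply_of_mem _ _ (Set.mem_range_self i)]
  have : (⟨φ i, Set.mem_range_self i⟩ : {x // x ∈ Set.range φ}) = Equiv.ofInjective φ hφ i := rfl
  rw [this]
  simp [e]

namespace IsPlanarSubalgebra

variable {X : Type*} [Finite X] {Q : ∀ n, Submodule ℂ (SpinBox X n)}

theorem const_mem (hQ : IsPlanarSubalgebra Q) : ∀ n, (fun _ => 1 : SpinBox X n) ∈ Q n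
  | 0 => hQ.one_mem
  | n + 1 => hQ.cup_mem 0 (hQ.const_mem n)

theorem pullback_castAdd_mem (hQ : IsPlanarSubalgebra Q) {m : ℕ} {f : SpinBox X m} (hf : f ∈ Q m) :
    ∀ d : ℕ, (fun x => f (fun i => x (Fin.castAdd d i)) : SpinBox X (m + d)) ∈ Q (m + d)
  | 0 => hf
  | d + 1 => by
    have h := hQ.cup_mem (Fin.last _) (hQ.pullback_castAdd_mem hf d)
    simp only [Fin.removeNth, Fin.succAbove_last] at h
    exact h

variable [Fintype X]

open Classical in
/-- Membership of the crossing makes a planar subalgebra stable under all permutations. -/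
theorem perm_mem (hQ : IsPlanarSubalgebra Q)
    (hc : (fun x => if x 0 = x 2 ∧ x 1 = x 3 then 1 else 0 : SpinBox X 4) ∈ Q 4)
    {n : ℕ} {f : SpinBox X n} (hf : f ∈ Q n) (π : Equiv.Perm (Fin n)) :
    (fun x => f (fun i => x (π i)) : SpinBox X n) ∈ Q n := by
  rcases n with _ | _ | n
  · rw [Subsingleton.elim π 1]
    exact hf
  · rw [show π = 1 from Equiv.ext fun i => Subsingleton.elim (α := Fin 1) _ _]
    exact hf
  -- A full cycle and one adjacent transposition generate the symmetric group: the cycle acts by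
  -- rotation, the transposition by the crossing with weight `1`.
  have hπ : π ∈ Subgroup.closure {finRotate (n + 2), Equiv.swap (Fin.last n).castSucc
      (finRotate (n + 2) (Fin.last n).castSucc)} := by
    rw [Equiv.Perm.closure_cycle_adjacent_swap isCycle_finRotate support_finRotate]
    trivial
  induction hπ using Subgroup.closure_induction generalizing f with
  | mem σ hσ =>
    rcases hσ with rfl | hσ
    · exact hQ.rotate_mem hf
    · rw [Set.mem_singleton_iff.1 hσ]
      have h1 := hQ.swap_mem_last (R := fun _ _ => 1)
        (F := fun u a b => f (Fin.snoc (Fin.snoc u a : Fin (n + 1) → X) b)) (by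
          convert hf using 1
          funext x
          congr 1
          funext i
          refine Fin.lastCases ?_ (fun i => ?_) i
          · simp
          · refine Fin.lastCases ?_ (fun i => ?_) i <;> simp) hc
      convert h1 using 1
      funext x
      rw [one_mul]
      congr 1
      have hl : finRotate (n + 2) (Fin.last n).castSucc = Fin.last (n + 1) := by
        rw [finRotate_apply]
        simp
      rw [hl]
      funext i
      refine Fin.lastCases ?_ (fun i => ?_) i
      · simp
      · refine Fin.lastCases ?_ (fun i => ?_) i
        · simp
        · rw [Equiv.swap_apply_of_ne_of_ne]
          · simp
          · simp [Fin.ext_iff, i.2.ne]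
          · simp [Fin.ext_iff]
            omega
  | one => exact hf
  | mul σ τ _ _ h1 h2 => exact h1 (h2 hf)
  | inv σ _ h =>
    -- By finite order the inverse is a nonnegative power, so stability under `σ` suffices.
    have hpow : ∀ k : ℕ, (fun x => f (fun i => x ((σ ^ k) i)) : SpinBox X (n + 2)) ∈ Q (n + 2) := by
      intro k
      induction k with
      | zero => exact hf
      | succ k ih =>
        rw [pow_succ']
        exact h ih
    rw [← mul_one σ⁻¹, ← pow_orderOf_eq_one σ,
      ← Nat.succ_pred_eq_of_pos (orderOf_pos σ), pow_succ', inv_mul_cancel_left]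
    exact hpow _

open Classical in
-- An injective reindexing is padding by unconstrained spins followed by a permutation. Otherwise
-- two identified arguments are moved to the front and merged, which lowers `m`.
theorem pullback_mem (hQ : IsPlanarSubalgebra Q)
    (hc : (fun x => if x 0 = x 2 ∧ x 1 = x 3 then 1 else 0 : SpinBox X 4) ∈ Q 4)
    {m n : ℕ} {f : SpinBox X m} (hf : f ∈ Q m) (φ : Fin m → Fin n) :
    (fun x => f (fun i => x (φ i)) : SpinBox X n) ∈ Q n := by
  by_cases hφ : Function.Injective φ
  · have hmn : m ≤ n := by simpa using Fintype.card_le_of_injective φ hφ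
    obtain ⟨d, rfl⟩ := Nat.exists_eq_add_of_le hmn
    obtain ⟨π, hπ⟩ := Fin.exists_perm_comp_eq (Fin.castAdd_injective m d) hφ
    simpa only [hπ] using hQ.perm_mem hc (hQ.pullback_castAdd_mem hf d) π
  · rw [Function.not_injective_iff] at hφ
    obtain ⟨i, j, hij, hne⟩ := hφ
    match m, f, hf, φ, i, j, hij, hne with
    | 0, _, _, _, i, _, _, _ => exact i.elim0
    | 1, _, _, _, i, j, _, hne => exact absurd (Subsingleton.elim i j) hne
    | m + 2, f, hf, φ, i, j, hij, hne =>
      obtain ⟨π, hπ⟩ := Fin.exists_perm_comp_eq (φ := ![(0 : Fin (m + 2)), 1]) (ψ := ![i, j])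
        (by simp [Function.Injective, Fin.forall_fin_two])
        (by simp [Function.Injective, Fin.forall_fin_two, hne, hne.symm])
      have h0 : π 0 = i := hπ 0
      have h1 : π 1 = j := hπ 1
      have h2 := hQ.merge_mem 0 (hQ.perm_mem hc hf π⁻¹)
      convert hQ.pullback_mem hc h2 (fun i => φ (π i.succ)) using 1
      funext x
      congr 1
      funext k
      obtain ⟨l, rfl⟩ := π.surjective k
      rw [show π⁻¹ (π l) = l from π.symm_apply_apply l]
      refine Fin.cases ?_ (fun l => ?_) l
      · simp [h0, h1, hij]
      · simp
termination_by m

open Classical in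
-- The pointwise product is the tensor product restricted to the diagonal.
theorem mul_mem (hQ : IsPlanarSubalgebra Q)
    (hc : (fun x => if x 0 = x 2 ∧ x 1 = x 3 then 1 else 0 : SpinBox X 4) ∈ Q 4)
    {n : ℕ} {f g : SpinBox X n} (hf : f ∈ Q n) (hg : g ∈ Q n) : f * g ∈ Q n := by
  convert hQ.pullback_mem hc (hQ.tensor_mem hf hg) (Fin.addCases id id) using 1
  funext x
  simp only [Pi.mul_apply, Fin.addCases_left, Fin.addCases_right, id]

open Classical in
theorem prod_mem (hQ : IsPlanarSubalgebra Q)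
    (hc : (fun x => if x 0 = x 2 ∧ x 1 = x 3 then 1 else 0 : SpinBox X 4) ∈ Q 4)
    {n : ℕ} {ι : Type*} (s : Finset ι) {f : ι → SpinBox X n} (hf : ∀ i, f i ∈ Q n) :
    ∏ i ∈ s, f i ∈ Q n := by
  induction s using Finset.induction_on with
  | empty => exact hQ.const_mem n
  | insert a s ha ih =>
    rw [Finset.prod_insert ha]
    exact hQ.mul_mem hc (hf a) ih

theorem sum_append_mem (hQ : IsPlanarSubalgebra Q) {k : ℕ} : ∀ {N : ℕ} {f : SpinBox X (k + N)},
    f ∈ Q (k + N) → (fun w => ∑ y : Fin N → X, f (Fin.append w y) : SpinBox X k) ∈ Q k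
  | 0, f, hf => by
    have h : (fun w => ∑ y : Fin 0 → X, f (Fin.append w y) : SpinBox X k) = f := by
      funext w
      rw [Fintype.sum_unique]
      congr 1
      funext i
      exact Fin.append_left w _ i
    rw [h]
    exact hf
  | N + 1, f, hf => by
    convert hQ.sum_append_mem (hQ.sum_mem (n := k + N) (Fin.last _) hf) using 1
    funext w
    rw [← (Fin.snocEquiv fun _ : Fin (N + 1) => X).sum_comp, Fintype.sum_prod_type_right]
    refine Finset.sum_congr rfl fun y _ => Finset.sum_congr rfl fun a _ => ?_
    congr 1
    rw [Fin.insertNth_last']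
    exact Fin.append_snoc _ _ _

open Classical in
/-- A box that is invariant under a set of self-maps of `X` whose indicator function belongs to
a planar subalgebra with crossing belongs to that subalgebra. -/
theorem mem_of_invariant (hQ : IsPlanarSubalgebra Q)
    (hc : (fun x => if x 0 = x 2 ∧ x 1 = x 3 then 1 else 0 : SpinBox X 4) ∈ Q 4)
    {N : ℕ} (e : Fin N ≃ X) {P : Set (X → X)} (hid : id ∈ P)
    (hP : (fun y => if (fun a => y (e.symm a)) ∈ P then 1 else 0 : SpinBox X N) ∈ Q N)
    {k : ℕ} {f : SpinBox X k}
    (hf : ∀ φ ∈ P, Function.Bijective φ ∧ ∀ z, f (fun i => φ (z i)) = f z) : f ∈ Q k := by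
  have hE : ∀ z : Fin k → X, (∏ i : Fin k, (fun x : Fin (k + N) → X =>
      if x (Fin.castAdd N i) = x (Fin.natAdd k (e.symm (z i))) then (1 : ℂ) else 0)) ∈ Q (k + N) :=
    fun z => hQ.prod_mem hc _ fun i => hQ.pullback_mem hc hQ.delta_mem
      ![Fin.castAdd N i, Fin.natAdd k (e.symm (z i))]
  have hP' := hQ.pullback_mem hc hP (Fin.natAdd k)
  have h1 : ∑ z : Fin k → X, f z • (fun w => ∑ y : Fin N → X, ((fun x : Fin (k + N) → X =>
      if (fun a => x (Fin.natAdd k (e.symm a))) ∈ P then (1 : ℂ) else 0) *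
      ∏ i : Fin k, (fun x : Fin (k + N) → X => if x (Fin.castAdd N i) =
        x (Fin.natAdd k (e.symm (z i))) then (1 : ℂ) else 0)) (Fin.append w y)) ∈ Q k :=
    (Q k).sum_mem fun z _ => (Q k).smul_mem _ (hQ.sum_append_mem (hQ.mul_mem hc hP' (hE z)))
  -- The identity lies in `P`, so the average over `P` makes sense.
  have hpos : ((Finset.univ.filter fun y : Fin N → X => (fun a => y (e.symm a)) ∈ P).card : ℂ)
      ≠ 0 := by
    rw [Nat.cast_ne_zero, ← Nat.pos_iff_ne_zero, Finset.card_pos]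
    exact ⟨e, by simpa [Function.id_def] using hid⟩
  -- Here `y` encodes a self-map of `X` and the product over `i` says that it sends `z` to `w`. For
  -- each `y` in `P` only the preimage `z` of `w` survives, and there `f z = f w` by invariance.
  have h2 : f = ((Finset.univ.filter fun y : Fin N → X => (fun a => y (e.symm a)) ∈ P).card : ℂ)⁻¹ •
      ∑ z : Fin k → X, f z • (fun w => ∑ y : Fin N → X, ((fun x : Fin (k + N) → X =>
      if (fun a => x (Fin.natAdd k (e.symm a))) ∈ P then (1 : ℂ) else 0) *
      ∏ i : Fin k, (fun x : Fin (k + N) → X => if x (Fin.castAdd N i) =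
        x (Fin.natAdd k (e.symm (z i))) then (1 : ℂ) else 0)) (Fin.append w y)) := by
    rw [eq_inv_smul_iff₀ hpos]
    funext w
    simp only [Finset.sum_apply, Pi.smul_apply, smul_eq_mul, Pi.mul_apply, Finset.prod_apply,
      Fin.append_left, Fin.append_right, Finset.mul_sum]
    rw [Finset.sum_comm, ← Finset.sum_boole, Finset.sum_mul]
    refine Finset.sum_congr rfl fun y _ => ?_
    by_cases hy : (fun a => y (e.symm a)) ∈ P
    · obtain ⟨hbij, hinv⟩ := hf _ hy
      simp only [hy, if_true, one_mul]
      let σ := Equiv.ofBijective _ hbij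
      have hσ : ∀ a, y (e.symm (σ.symm a)) = a := fun a => σ.apply_symm_apply a
      rw [Finset.sum_eq_single (fun i => σ.symm (w i))]
      · rw [← hinv (fun i => σ.symm (w i))]
        simp [hσ]
      · intro z _ hz
        obtain ⟨i, hi⟩ := Function.ne_iff.1 hz
        rw [Finset.prod_eq_zero (Finset.mem_univ i), mul_zero]
        rw [if_neg]
        intro h
        apply hi
        rw [Equiv.eq_symm_apply]
        exact h.symm
      · simp
    · simp [hy]
  rw [h2]
  exact (Q k).smul_mem _ h1

end IsPlanarSubalgebra

/-! ### Generation and invariant boxes -/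

theorem mem_planarGenerated {X : Type*} [Finite X] {m n : ℕ} {S : Set (SpinBox X m)}
    {f : SpinBox X n} : f ∈ planarGenerated S n ↔
      ∀ Q : ∀ k, Submodule ℂ (SpinBox X k), IsPlanarSubalgebra Q → S ⊆ Q m → f ∈ Q n := by
  rw [planarGenerated, Submodule.mem_sInf]
  constructor
  · intro h Q hQ hS
    exact h _ ⟨Q, hQ, hS, rfl⟩
  · rintro h _ ⟨Q, hQ, hS, rfl⟩
    exact h Q hQ hS

theorem planarGenerated_le {X : Type*} [Finite X] {m n : ℕ} {S : Set (SpinBox X m)}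
    {Q : ∀ k, Submodule ℂ (SpinBox X k)} (hQ : IsPlanarSubalgebra Q) (hS : S ⊆ Q m) :
    planarGenerated S n ≤ Q n := fun _ hf => mem_planarGenerated.1 hf Q hQ hS

theorem isPlanarSubalgebra_groupActionModel (G X : Type*) [Group G] [MulAction G X] [Finite X] :
    IsPlanarSubalgebra (groupActionModel G X) where
  one_mem _ _ := rfl
  tensor_mem hf hg g x := congr_arg₂ (· * ·) (hf g _) (hg g _)
  rotate_mem hf g x := hf g _
  cap_mem {n f} k hf g x := by
    change ∑ᶠ a, f (k.insertNth a fun i => g • x i) = ∑ᶠ a, f (k.insertNth a x)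
    rw [← finsum_comp_equiv (MulAction.toPerm g)]
    refine finsum_congr fun a => ?_
    rw [← hf g (k.insertNth a x)]
    congr 1
    funext i
    refine Fin.succAboveCases k ?_ (fun i => ?_) i <;> simp
  merge_mem k hf g x := hf g _
  cup_mem k hf g x := hf g _
  split_mem {n f} k hf g x := by
    classical
    exact if_congr (smul_left_cancel_iff g) (hf g _) rfl

namespace IsPairLabelling

variable {X : Type*} [Finite X] {Q : ∀ n, Submodule ℂ (SpinBox X n)} {n : ℕ}
  {p : X → Finset (Fin n)}

open Classical in
/-- The main result for an arbitrary action on pairs: a planar subalgebra that contains the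
disjointness relation contains all the invariant boxes. -/
theorem groupActionModel_le (hn : 5 ≤ n) (hp : IsPairLabelling p) [MulAction (Equiv.Perm (Fin n)) X]
    (hsmul : ∀ (g : Equiv.Perm (Fin n)) x, p (g • x) = (p x).map g.toEmbedding)
    (hQ : IsPlanarSubalgebra Q)
    (hD : (fun x => if Disjoint (p (x 0)) (p (x 1)) then 1 else 0 : SpinBox X 2) ∈ Q 2) (k : ℕ) :
    groupActionModel (Equiv.Perm (Fin n)) X k ≤ Q k := by
  intro f hf
  have : Fintype X := Fintype.ofFinite X
  have hc := hp.crossing_mem (by simpa using hn) hQ hD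
  let e : Fin (Fintype.card X) ≃ X := (Fintype.equivFin X).symm
  let P : Set (X → X) := {φ | ∀ x y, Disjoint (p (φ x)) (p (φ y)) ↔ Disjoint (p x) (p y)}
  have hs : ∀ a : Fin n, (finRotate n a).1 = if a.1 + 1 = n then 0 else a.1 + 1 := by
    intro a
    obtain ⟨m, rfl⟩ : ∃ m, n = m + 1 := ⟨n - 1, by omega⟩
    rw [coe_finRotate]
    simp [Fin.ext_iff]
  have hP : (fun y => if (fun a => y (e.symm a)) ∈ P then 1 else 0 : SpinBox X _) ∈ Q _ := by
    -- Membership in `P` is one condition for each pair `q`, with indicator `D` or `1 - D` according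
    -- to whether the labels of `q` are disjoint.
    have h1 := hQ.prod_mem hc Finset.univ (f := fun q : X × X =>
      fun y : Fin (Fintype.card X) → X => if (Disjoint (p (y (e.symm q.1))) (p (y (e.symm q.2))) ↔
        Disjoint (p q.1) (p q.2)) then 1 else 0) (fun q => by
        have hD' : (fun y => if Disjoint (p (y (e.symm q.1))) (p (y (e.symm q.2))) then 1 else 0 :
            SpinBox X _) ∈ Q _ := hQ.pullback_mem hc hD ![e.symm q.1, e.symm q.2]
        by_cases hq : Disjoint (p q.1) (p q.2)
        · simp only [hq, iff_true]
          exact hD'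
        · convert (Q _).sub_mem (hQ.const_mem _) hD' using 1
          funext y
          simp only [hq, iff_false, Pi.sub_apply]
          split_ifs <;> simp)
    convert h1 using 1
    funext y
    simp [Finset.prod_apply, Finset.prod_ite_zero, P]
  refine hQ.mem_of_invariant hc e (P := P) (fun x y => Iff.rfl) (by convert hP) fun φ hφ => ?_
  -- `finRotate n` is a single cycle of length `n ≥ 5`, so none of its first four powers fixes a
  -- point.
  obtain ⟨π, hπ⟩ := hp.exists_perm (finRotate n)
    (fun a h => by have := hs a; rw [Fin.ext_iff] at h; split_ifs at this <;> omega)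
    (fun a h => by
      have := hs a; have := hs (finRotate n a); rw [Fin.ext_iff] at h
      split_ifs at * <;> omega)
    (fun a h => by
      have := hs a; have := hs (finRotate n a); have := hs (finRotate n (finRotate n a))
      rw [Fin.ext_iff] at h
      split_ifs at * <;> omega)
    (fun a h => by
      have := hs a; have := hs (finRotate n a); have := hs (finRotate n (finRotate n a))
      have := hs (finRotate n (finRotate n (finRotate n a)))
      rw [Fin.ext_iff] at h
      split_ifs at * <;> omega) hφ
  have hφ' : φ = fun x => π • x := by
    funext x
    exact hp.injective ((hπ x).trans (hsmul π x).symm)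
  rw [hφ']
  exact ⟨MulAction.bijective π, fun z => hf π z⟩

end IsPairLabelling

/-! ### The Kneser graph -/

theorem isPairLabelling_powersetCard (n : ℕ) :
    IsPairLabelling (fun s : Set.powersetCard (Fin n) 2 => (s : Finset (Fin n))) where
  injective := Subtype.val_injective
  card_eq s := s.2
  exists_eq a b h := ⟨⟨{a, b}, Finset.card_pair h⟩, rfl⟩

open Classical in
theorem adjacencyBox_kneserGraph_two (n : ℕ) : adjacencyBox (kneserGraph n 2) = fun x =>
    if Disjoint (x 0 : Finset (Fin n)) (x 1 : Finset (Fin n)) then 1 else 0 := by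
  funext x
  unfold adjacencyBox
  have := (isPairLabelling_powersetCard n).trichotomy (x 0) (x 1)
  refine if_congr ⟨fun h => h.2, fun h => ⟨?_, h⟩⟩ rfl rfl
  tauto

theorem adjacencyBox_mem_groupActionModel {V : Type*} (Γ : SimpleGraph V) :
    adjacencyBox Γ ∈ groupActionModel (Γ ≃g Γ) V 2 := by
  intro g x
  classical
  exact if_congr g.map_rel_iff rfl rfl

theorem coe_smul_powersetCard {n : ℕ} (g : Equiv.Perm (Fin n)) (s : Set.powersetCard (Fin n) 2) :
    ((g • s : Set.powersetCard (Fin n) 2) : Finset (Fin n)) =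
      (s : Finset (Fin n)).map g.toEmbedding := by
  rw [Finset.map_eq_image]
  rfl

theorem groupActionModel_le_kneserGraph {n : ℕ} (hn : 5 ≤ n) (k : ℕ)
    {Q : ∀ n', Submodule ℂ (SpinBox (Set.powersetCard (Fin n) 2) n')} (hQ : IsPlanarSubalgebra Q)
    (hA : adjacencyBox (kneserGraph n 2) ∈ Q 2) :
    groupActionModel (Equiv.Perm (Fin n)) (Set.powersetCard (Fin n) 2) k ≤ Q k :=
  (isPairLabelling_powersetCard n).groupActionModel_le hn coe_smul_powersetCard hQ
    (adjacencyBox_kneserGraph_two n ▸ hA) k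

theorem adjacencyBox_kneserGraph_mem (n : ℕ) : adjacencyBox (kneserGraph n 2) ∈
    groupActionModel (Equiv.Perm (Fin n)) (Set.powersetCard (Fin n) 2) 2 := by
  classical
  intro g x
  rw [adjacencyBox_kneserGraph_two]
  simp only [coe_smul_powersetCard, Finset.disjoint_map]

theorem generatedByTwoBoxes_of_le {G X : Type*} [Group G] [MulAction G X] [Finite X]
    {f : SpinBox X 2} (hf : f ∈ groupActionModel G X 2)
    (h : ∀ (k : ℕ) (Q : ∀ n, Submodule ℂ (SpinBox X n)), IsPlanarSubalgebra Q → f ∈ Q 2 →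
      groupActionModel G X k ≤ Q k) : GeneratedByTwoBoxes G X := fun k =>
  le_antisymm (planarGenerated_le (isPlanarSubalgebra_groupActionModel G X) subset_rfl)
    fun _ hg => mem_planarGenerated.2 fun Q hQ hS => h k Q hQ (hS hf) hg

/-! ### Cosets and the main theorem -/

open Classical in
/-- The pair that labels a coset: the image of `{0, 1}`. -/
noncomputable def cosetPair (n : ℕ) (q : Equiv.Perm (Fin n) ⧸ twoSubsetSubgroup n) :
    Finset (Fin n) :=
  (MulAction.ofQuotientStabilizer (Equiv.Perm (Fin n)) {i : Fin n | (i : ℕ) < 2} q).toFinset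

theorem coe_cosetPair (n : ℕ) (q : Equiv.Perm (Fin n) ⧸ twoSubsetSubgroup n) :
    (cosetPair n q : Set (Fin n)) =
      MulAction.ofQuotientStabilizer (Equiv.Perm (Fin n)) {i : Fin n | (i : ℕ) < 2} q := by
  simp [cosetPair]

theorem cosetPair_smul {n : ℕ} (g : Equiv.Perm (Fin n))
    (q : Equiv.Perm (Fin n) ⧸ twoSubsetSubgroup n) :
    cosetPair n (g • q) = (cosetPair n q).map g.toEmbedding := by
  apply Finset.coe_injective
  rw [coe_cosetPair, Finset.coe_map, coe_cosetPair]
  exact MulAction.ofQuotientStabilizer_smul _ _ g q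

theorem cosetPair_mk {n : ℕ} (hn : 2 ≤ n) (g : Equiv.Perm (Fin n)) :
    cosetPair n (QuotientGroup.mk g) = {g ⟨0, by omega⟩, g ⟨1, by omega⟩} := by
  apply Finset.coe_injective
  rw [coe_cosetPair]
  refine (MulAction.ofQuotientStabilizer_mk _ _ g).trans ?_
  have : {i : Fin n | (i : ℕ) < 2} = {⟨0, by omega⟩, ⟨1, by omega⟩} := by
    ext i
    simp [Fin.ext_iff]
    omega
  rw [this]
  simp [Set.smul_set_insert]

theorem isPairLabelling_cosetPair {n : ℕ} (hn : 2 ≤ n) : IsPairLabelling (cosetPair n) where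
  injective q q' h := by
    apply MulAction.injective_ofQuotientStabilizer (Equiv.Perm (Fin n)) {i : Fin n | (i : ℕ) < 2}
    rw [← coe_cosetPair, ← coe_cosetPair, h]
  card_eq q := by
    induction q using QuotientGroup.induction_on with
    | H g => rw [cosetPair_mk hn, Finset.card_pair (g.injective.ne (by simp))]
  exists_eq a b h := by
    obtain ⟨g, hg⟩ := Fin.exists_perm_comp_eq
      (φ := ![(⟨0, by omega⟩ : Fin n), ⟨1, by omega⟩]) (ψ := ![a, b])
      (by simp [Function.Injective, Fin.forall_fin_two])
      (by simp [Function.Injective, Fin.forall_fin_two, h, h.symm])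
    refine ⟨QuotientGroup.mk g, ?_⟩
    rw [cosetPair_mk hn]
    exact congr_arg₂ _ (hg 0) (congr_arg _ (hg 1))

theorem mainTheorem1 (n : ℕ) (hn : 5 ≤ n) :
    PropertyG (kneserGraph n 2) ∧
    (∀ k : ℕ, planarGenerated {adjacencyBox (kneserGraph n 2)} k =
      groupActionModel (Equiv.Perm (Fin n)) (Set.powersetCard (Fin n) 2) k) ∧
    GeneratedByTwoBoxes (Equiv.Perm (Fin n)) (Set.powersetCard (Fin n) 2) ∧
    GeneratedByTwoBoxes (Equiv.Perm (Fin n)) (Equiv.Perm (Fin n) ⧸ twoSubsetSubgroup n) := by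
  have hle : ∀ k, groupActionModel (Equiv.Perm (Fin n)) (Set.powersetCard (Fin n) 2) k ≤
      planarGenerated {adjacencyBox (kneserGraph n 2)} k := fun k f hf =>
    mem_planarGenerated.2 fun Q hQ hS =>
      groupActionModel_le_kneserGraph hn k hQ (hS (Set.mem_singleton _)) hf
  refine ⟨fun k => le_antisymm ?_ ?_, fun k => le_antisymm ?_ (hle k), ?_, ?_⟩
  · exact planarGenerated_le (isPlanarSubalgebra_groupActionModel _ _)
      (Set.singleton_subset_iff.2 (adjacencyBox_mem_groupActionModel _))
  -- Only the easy inclusion of `S_n` in the automorphism group is needed here: invariance under all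
  -- automorphisms implies invariance under `S_n`.
  · refine le_trans (b := groupActionModel (Equiv.Perm (Fin n)) _ k) (fun f hf g x => ?_) (hle k)
    let γ : kneserGraph n 2 ≃g kneserGraph n 2 :=
      { toEquiv := MulAction.toPerm g
        map_rel_iff' := by
          intro s t
          change (g • s ≠ g • t ∧ Disjoint (g • s).1 (g • t).1) ↔ (s ≠ t ∧ Disjoint s.1 t.1)
          rw [(MulAction.injective g).ne_iff, coe_smul_powersetCard, coe_smul_powersetCard,
            Finset.disjoint_map] }
    exact hf γ x
  · exact planarGenerated_le (isPlanarSubalgebra_groupActionModel _ _)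
      (Set.singleton_subset_iff.2 (adjacencyBox_kneserGraph_mem n))
  · exact generatedByTwoBoxes_of_le (adjacencyBox_kneserGraph_mem n) fun k Q hQ hA =>
      groupActionModel_le_kneserGraph hn k hQ hA
  · classical
    refine generatedByTwoBoxes_of_le (f := fun x =>
      if Disjoint (cosetPair n (x 0)) (cosetPair n (x 1)) then 1 else 0) ?_ fun k Q hQ hA =>
      (isPairLabelling_cosetPair (by omega)).groupActionModel_le hn cosetPair_smul hQ
        (by convert hA) k
    intro g x
    simp only [cosetPair_smul, Finset.disjoint_map]
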